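/- **Runs and games.** There are two players, the machine $\top$ and the environment $\bot$; $\neg\wp$ is the adversary of $\wp$. Variables are $v_0,v_1,v_2,\dots$, constants are $0,1,2,\dots$ (identified with their decimal numerals when used as moves), and a term is a variable or a constant. A valuation $e$ is a function from variables to constants, extended to terms by $e(c)=c$. A move is a finite string over the keyboard alphabet plus the symbol $\spadesuit$; a labmove is a move labeled by a player; a run is a finite or infinite sequence of labmoves, and a position is a finite run. A game $A$ assigns to each valuation $e$ a set $\mathbf{Lr}^A_e$ of (legal) runs and to each $e$ and run $\Gamma$ a winner $\mathbf{Wn}^A_e\langle\Gamma\rangle\in\{\top,\bot\}$, such that (a) a run is legal iff all its nonempty finite initial segments are legal; (b) no legal run contains the move $\spadesuit$; (c) if the shortest illegal initial segment of $\Gamma$ ends with a move of $\wp$, then $\mathbf{Wn}^A_e\langle\Gamma\rangle=\neg\wp$. $A$ is elementary if the empty run is its only legal run; $A$ depends on $x$ if two valuations differing at most at $x$ give different legal runs or different winners. $A[x_1/t_1,\dots,x_n/t_n]$ is $A$ evaluated at the valuation that sends $x_i$ to $e(t_i)$ and agrees with $e$ elsewhere. **Operations** (winners are given for legal runs; for illegal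 runs they are fixed by (c)). $\neg A$ switches the roles of the players. The legal runs of $A_1\wedge\dots\wedge A_n$ are those whose every move has a prefix "$i.$" with $1\le i\le n$ and whose $i$-th component $\Gamma^{i.}$ (the moves with prefix "$i.$", with the prefix deleted) is legal for $A_i$, for each $i$; $\top$ wins iff it wins all components. The legal runs of $A_1\sqcap\dots\sqcap A_n$ are the empty run and $\langle\bot i,\Delta\rangle$ with $1\le i\le n$ and $\Delta$ legal for $A_i$; $\bot$ wins iff the run is such a $\langle\bot i,\Delta\rangle$ with $\Delta$ won by $\bot$ in $A_i$. $\sqcap xA$ is defined likewise, with a choice among the games $A[x/c]$, $c$ a constant, by the move $c$. $\forall xA$ has the legal runs of $A$, and $\top$ wins iff it wins $A[x/c]$ for every constant $c$. $\vee,\sqcup,\sqcup x,\exists x$ are the De Morgan duals, $A\to B$ is $\neg A\vee B$, and $\top,\bot$ also denote the elementary games always won by that player. **Formulas.** Formulas are built from $\top$, $\bot$ and atoms $p(t_1,\dots,t_n)$ ($p$ an $n$-ary predicate letter, $t_i$ terms) by $\neg$, $\to$, $n$-ary $\wedge,\vee,\sqcap,\sqcup$ ($n\ge2$), and the quantifiers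 $\forall x,\exists x,\sqcap x,\sqcup x$. An interpretation $^*$ sends each $n$-ary predicate letter $p$ to an elementary game $p^*=A(x_1,\dots,x_n)$ with an attached tuple of distinct variables; it extends to formulas by $p(t_1,\dots,t_n)^*=A[x_1/t_1,\dots,x_n/t_n]$ and by commuting with all operations. It is $F$-admissible if, for every predicate letter $p$, $p^*$ depends on no variable that occurs in $F$ and is not in the tuple attached to $p$. **Machines.** A hard-play machine (HPM) is a Turing machine with a read-only valuation tape (listing $e(v_0),e(v_1),\dots$), a read-only run tape (spelling the current position, initially empty), a read/write work tape (initially empty), and some states designated as move states. In each clock cycle it performs one transition; if it is in a move state, it makes the move $\alpha$ written at the beginning of its work tape. If in that cycle the environment makes the (finitely many, arbitrary) moves $\beta_1,\dots,\beta_k$, then $\bot\beta_1,\dots,\bot\beta_k$, followed by $\top\alpha$ if the machine has moved, are appended to the position. An HPM $\mathcal H$ wins a game $A$ if, for every valuation $e$ and all behaviors of the environment, the run $\Gamma$ generated in the whole (infinite) computation satisfies $\mathbf{Wn}^A_e\langle\Gamma\rangle=\top$. A formula $F$ is *valid* if for every $F$-admissible interpretation $^*$ there is an HPM that wins $F^*$;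 it is *uniformly valid* if there is one HPM that wins $F^*$ for every $F$-admissible interpretation $^*$. **Theorem.** A formula is valid if and only if it is uniformly valid. -/

import Mathlib

namespace CoL

/-! ### Variables, constants, moves, runs -/

/-- The variables `v₀, v₁, v₂, …`, represented by their indices. -/
abbrev Var := ℕ

/-- A valuation sends every variable to a constant; the constants are `0, 1, 2, …`. -/
abbrev Valuation := Var → ℕ

inductive Term where
  | var (x : Var)
  | const (c : ℕ)

/-- Valuations extend to terms, with `e(c) = c` for constants. -/
def Term.eval (e : Valuation) : Term → ℕ
  | .var x => e x
  | .const c => c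

/-- The standard keyboard alphabet (the 95 printable characters: ten digits, the period and 84
others) together with the symbol `♠`. -/
inductive Key where
  | digit (d : Fin 10)
  | dot
  | other (i : Fin 84)
  | spade
  deriving DecidableEq

abbrev Move := List Key

/-- `top` is the machine, `bot` is the environment. -/
inductive Player where
  | top
  | bot
  deriving DecidableEq

def Player.neg : Player → Player
  | .top => .bot
  | .bot => .top

abbrev LabMove := Player × Move

abbrev Position := List LabMove

/-- Finite or infinite sequences of labmoves. -/
abbrev Run := Stream'.Seq LabMove

/-- A position regarded as a run. -/
abbrev Position.toRun (Φ : Position) : Run := Stream'.Seq.ofList Φ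

/-- `Φ` is a finite initial segment of `Γ`. -/
def IsInit (Φ : Position) (Γ : Run) : Prop :=
  ∀ n m, Φ[n]? = some m → Γ.get? n = some m

/-- The decimal numeral of `c`, most significant digit first. -/
def decimalDigits (c : ℕ) : List (Fin 10) :=
  if c = 0 then [0] else (Nat.digits 10 c).reverse.map (Fin.ofNat 10)

/-- The decimal numeral of `c` as a string of keyboard symbols. -/
def decimal (c : ℕ) : Move := (decimalDigits c).map Key.digit

theorem decimalDigits_val (c : ℕ) :
    Nat.ofDigits 10 ((decimalDigits c).map Fin.val).reverse = c := by
  unfold decimalDigits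
  split_ifs with h
  · subst h; simp
  · rw [List.map_map, ← List.map_reverse, List.reverse_reverse]
    have : (Nat.digits 10 c).map (Fin.val ∘ Fin.ofNat 10) = Nat.digits 10 c := by
      conv_rhs => rw [← List.map_id (Nat.digits 10 c)]
      apply List.map_congr_left
      intro d hd
      have := Nat.digits_lt_base (by norm_num : 1 < 10) hd
      simp [Fin.ofNat, Nat.mod_eq_of_lt this]
    rw [this, Nat.ofDigits_digits]

theorem decimal_injective : Function.Injective decimal := by
  intro a b h
  have h' : decimalDigits a = decimalDigits b :=
    List.map_injective_iff.2 (fun _ _ h => Key.digit.inj h) h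
  rw [← decimalDigits_val a, h', decimalDigits_val]

theorem decimal_head (c : ℕ) (l : Move) : decimal c ++ l ≠ [Key.spade] := by
  intro h
  have hne : decimalDigits c ≠ [] := by
    unfold decimalDigits
    split_ifs with hc
    · simp
    · simpa using Nat.digits_ne_nil_iff_ne_zero.2 hc
  obtain ⟨d, t, hd⟩ := List.exists_cons_of_ne_nil hne
  simp [decimal, hd] at h

/-- The run incrementally spelled by a growing sequence of positions. -/
noncomputable def Run.limit (s : ℕ → Position) : Run :=
  ⟨fun n => open scoped Classical in
      if h : ∃ m k, (s k)[n]? = some m then some h.choose else none, by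
    intro n hn
    have hn' : ¬ ∃ m k, (s k)[n]? = some m := by
      intro h
      simp [h] at hn
    have : ¬ ∃ m k, (s k)[n + 1]? = some m := by
      rintro ⟨m, k, hk⟩
      obtain ⟨hlt, -⟩ := List.getElem?_eq_some_iff.1 hk
      exact hn' ⟨(s k)[n], k, List.getElem?_eq_getElem (by omega)⟩
    simp [this]⟩

theorem Run.limit_get? {s : ℕ → Position} (hs : ∀ i j, i ≤ j → s i <+: s j) (n : ℕ)
    (m : LabMove) : (Run.limit s).get? n = some m ↔ ∃ k, (s k)[n]? = some m := by
  have key : ∀ k l m m', (s k)[n]? = some m → (s l)[n]? = some m' → m = m' := by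
    intro k l m m' h h'
    have h1 := (List.prefix_iff_getElem?.1 (hs k (max k l) (le_max_left _ _)))
    have h2 := (List.prefix_iff_getElem?.1 (hs l (max k l) (le_max_right _ _)))
    obtain ⟨a, ha⟩ := List.getElem?_eq_some_iff.1 h
    obtain ⟨b, hb⟩ := List.getElem?_eq_some_iff.1 h'
    have e1 := h1 n a
    have e2 := h2 n b
    rw [ha] at e1
    rw [hb] at e2
    exact Option.some.inj (e1.symm.trans e2)
  have hdef : (Run.limit s).get? n = open scoped Classical in
      if h : ∃ m k, (s k)[n]? = some m then some h.choose else none := rfl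
  rw [hdef]
  constructor
  · intro h
    split_ifs at h with hx
    obtain ⟨k, hk⟩ := hx.choose_spec
    exact ⟨k, by rw [hk]; exact h⟩
  · rintro ⟨k, hk⟩
    have hx : ∃ m k, (s k)[n]? = some m := ⟨m, k, hk⟩
    rw [dif_pos hx]
    obtain ⟨l, hl⟩ := hx.choose_spec
    rw [key l k _ _ hl hk]

/-- Switching all labels of a run. -/
def Run.neg (Γ : Run) : Run := Γ.map (fun m => (m.1.neg, m.2))

/-- If the move begins with `γ`, delete this prefix and keep the label. -/
def stripPrefix (γ : Move) (m : LabMove) : Option LabMove :=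
  if γ <+: m.2 then some (m.1, m.2.drop γ.length) else none

/-- `Γ^γ`: keep only the labmoves whose move begins with `γ`, and delete that prefix. -/
noncomputable def Run.proj (γ : Move) (Γ : Run) : Run :=
  Run.limit (fun k => (Γ.take k).filterMap (stripPrefix γ))

/-! ### Games -/

/-- The shortest illegal initial segment of `Γ` ends with a move of the player `p`, where `L` is
the set of legal runs. -/
def IllegalBy (L : Set Run) (p : Player) (Γ : Run) : Prop :=
  ∃ (Φ : Position) (α : Move), IsInit (Φ ++ [(p, α)]) Γ ∧
    Position.toRun (Φ ++ [(p, α)]) ∉ L ∧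
    ∀ Ψ : Position, Ψ <+: Φ → Position.toRun Ψ ∈ L

structure Game where
  legal : Valuation → Set Run
  win : Valuation → Run → Player
  legal_iff : ∀ e Γ, Γ ∈ legal e ↔
    ∀ Φ : Position, Φ ≠ [] → IsInit Φ Γ → Φ.toRun ∈ legal e
  no_spade : ∀ e, ∀ Γ ∈ legal e, ∀ p n, Γ.get? n ≠ some (p, [Key.spade])
  win_illegal : ∀ e Γ p, IllegalBy (legal e) p Γ → win e Γ = p.neg

/-- `A` depends on the variable `x`. -/
def Game.DependsOn (A : Game) (x : Var) : Prop :=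
  ∃ e₁ e₂ : Valuation, (∀ y, y ≠ x → e₁ y = e₂ y) ∧
    (A.legal e₁ ≠ A.legal e₂ ∨ A.win e₁ ≠ A.win e₂)

/-- Elementary games: the empty run is the only legal run. -/
def Game.IsElementary (A : Game) : Prop :=
  ∀ e, ∀ Γ ∈ A.legal e, Γ = Stream'.Seq.nil

theorem IsInit.toRun_iff {Φ Ψ : Position} : IsInit Φ Ψ.toRun ↔ Φ <+: Ψ := by
  rw [List.prefix_iff_getElem?]
  constructor
  · intro h i hi
    have := h i _ (List.getElem?_eq_getElem hi)
    simpa using this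
  · intro h n m hm
    obtain ⟨a, ha⟩ := List.getElem?_eq_some_iff.1 hm
    have := h n a
    rw [ha] at this
    simpa using this

theorem IsInit.comparable {Φ Ψ : Position} {Γ : Run} (h : IsInit Φ Γ) (h' : IsInit Ψ Γ)
    (hl : Φ.length ≤ Ψ.length) : Φ <+: Ψ := by
  rw [List.prefix_iff_getElem?]
  intro i hi
  have h1 := h i _ (List.getElem?_eq_getElem hi)
  have h2 := h' i _ (List.getElem?_eq_getElem (lt_of_lt_of_le hi hl))
  rw [List.getElem?_eq_getElem (lt_of_lt_of_le hi hl), ← h2, h1]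

theorem IllegalBy.unique {L : Set Run} {p q : Player} {Γ : Run}
    (h : IllegalBy L p Γ) (h' : IllegalBy L q Γ) : p = q := by
  obtain ⟨Φ, α, hi, hn, hl⟩ := h
  obtain ⟨Ψ, β, hi', hn', hl'⟩ := h'
  have main : ∀ {Φ Ψ : Position} {m m' : LabMove}, IsInit (Φ ++ [m]) Γ → IsInit (Ψ ++ [m']) Γ →
      Position.toRun (Φ ++ [m]) ∉ L → (∀ Θ : Position, Θ <+: Ψ → Position.toRun Θ ∈ L) →
      ¬ Φ.length < Ψ.length := by
    intro Φ Ψ m m' a b c d hlt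
    have hpre : Φ ++ [m] <+: Ψ ++ [m'] := a.comparable b (by simp; omega)
    have : Φ ++ [m] <+: Ψ :=
      List.prefix_of_prefix_length_le hpre (List.prefix_append _ _) (by simp; omega)
    exact c (d _ this)
  have h1 := main hi hi' hn hl'
  have h2 := main hi' hi hn' hl
  have hlen : Φ.length = Ψ.length := by omega
  have hpre := hi.comparable hi' (by simp [hlen])
  have heq := hpre.eq_of_length (by simp [hlen])
  have := List.append_inj_right heq hlen
  simp at this
  exact this.1

open scoped Classical in
/-- The game with the legal runs `L` whose legal runs have the winner given by `w`; an illegal run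
is lost by the player who made the first illegal move. -/
noncomputable def Game.ofLegal (L : Valuation → Set Run) (w : Valuation → Run → Player)
    (hL : ∀ e Γ, Γ ∈ L e ↔ ∀ Φ : Position, Φ ≠ [] → IsInit Φ Γ → Φ.toRun ∈ L e)
    (hs : ∀ e, ∀ Γ ∈ L e, ∀ p n, Γ.get? n ≠ some (p, [Key.spade])) : Game where
  legal := L
  win e Γ := if Γ ∈ L e then w e Γ else if IllegalBy (L e) .top Γ then .bot else .top
  legal_iff := hL
  no_spade := hs
  win_illegal := by
    intro e Γ p h
    have hΓ : Γ ∉ L e := by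
      obtain ⟨Φ, α, hi, hn, -⟩ := h
      exact fun hΓ => hn ((hL e Γ).1 hΓ _ (by simp) hi)
    rw [if_neg hΓ]
    cases p with
    | top => rw [if_pos h]; rfl
    | bot =>
      rw [if_neg]
      · rfl
      · exact fun h' => by cases h.unique h'

theorem Game.legal_of_init (A : Game) {e : Valuation} {Γ : Run} (h : Γ ∈ A.legal e)
    {Φ : Position} (hi : IsInit Φ Γ) : Φ.toRun ∈ A.legal e := by
  rw [A.legal_iff]
  intro Ψ hne hΨ
  refine (A.legal_iff e Γ).1 h Ψ hne (fun n m hm => hi n m ?_)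
  simpa using hΨ n m hm

/-! ### Operations on games -/

/-- `A[x₁/t₁, …, xₙ/tₙ]`: the game `A` evaluated at the valuation that sends `xᵢ` to `e(tᵢ)` and
agrees with `e` elsewhere (the `xᵢ` are meant to be pairwise distinct). -/
noncomputable def Game.subst (A : Game) {n : ℕ} (xs : Fin n → Var) (ts : Fin n → Term) : Game where
  legal e := A.legal (Function.extend xs (fun i => (ts i).eval e) e)
  win e := A.win (Function.extend xs (fun i => (ts i).eval e) e)
  legal_iff _ := A.legal_iff _
  no_spade _ := A.no_spade _
  win_illegal _ := A.win_illegal _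

/-- `A[x/c]` for a constant `c`. -/
def Game.inst (A : Game) (x : Var) (c : ℕ) : Game where
  legal e := A.legal (Function.update e x c)
  win e := A.win (Function.update e x c)
  legal_iff _ := A.legal_iff _
  no_spade _ := A.no_spade _
  win_illegal _ := A.win_illegal _

/-- The trivial game won by `p`. -/
noncomputable def Game.trivial (p : Player) : Game :=
  Game.ofLegal (fun _ => {Stream'.Seq.nil}) (fun _ _ => p)
    (by
      intro e Γ
      constructor
      · rintro rfl Φ hne hi
        obtain ⟨m, t, rfl⟩ := List.exists_cons_of_ne_nil hne
        have := hi 0 m (by simp)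
        simp at this
      · intro h
        by_contra hΓ
        have h0 : Γ.get? 0 ≠ none := fun h0 => hΓ (Stream'.Seq.get?_zero_eq_none.1 h0)
        obtain ⟨m, hm⟩ := Option.ne_none_iff_exists'.1 h0
        have := h [m] (by simp) (by
          intro n m' hm'
          cases n with
          | zero => simp at hm'; rw [hm, hm']
          | succ n => simp at hm')
        have h2 : (Position.toRun [m]).get? 0 = none := by
          rw [Set.mem_singleton_iff.1 this]; simp
        simp at h2)
    (by
      rintro e Γ rfl p n
      simp)

theorem Run.neg_neg (Γ : Run) : Γ.neg.neg = Γ := by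
  apply Stream'.Seq.ext
  intro n
  unfold Run.neg
  rw [Stream'.Seq.map_get?, Stream'.Seq.map_get?]
  cases Γ.get? n with
  | none => rfl
  | some m => obtain ⟨p, α⟩ := m; cases p <;> rfl

/-- Switching all labels of a position. -/
def Position.neg (Φ : Position) : Position := Φ.map (fun m => (m.1.neg, m.2))

theorem Position.neg_neg (Φ : Position) : Φ.neg.neg = Φ := by
  unfold Position.neg
  rw [List.map_map]
  conv_rhs => rw [← List.map_id Φ]
  apply List.map_congr_left
  rintro ⟨p, α⟩ -
  cases p <;> rfl

theorem Position.toRun_neg (Φ : Position) : Run.neg Φ.toRun = Φ.neg.toRun := by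
  apply Stream'.Seq.ext
  intro n
  unfold Run.neg Position.neg
  rw [Stream'.Seq.map_get?]
  simp

theorem IsInit.neg {Φ : Position} {Γ : Run} (h : IsInit Φ Γ) : IsInit Φ.neg Γ.neg := by
  intro n m hm
  unfold Position.neg at hm
  rw [List.getElem?_map] at hm
  obtain ⟨m', h1, h2⟩ := Option.map_eq_some_iff.1 hm
  unfold Run.neg
  rw [Stream'.Seq.map_get?, h n m' h1, ← h2]
  rfl

/-- Negation `¬A`: the roles of the players are switched. -/
def Game.neg (A : Game) : Game where
  legal e := {Γ | Γ.neg ∈ A.legal e}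
  win e Γ := (A.win e Γ.neg).neg
  legal_iff := by
    intro e Γ
    change Γ.neg ∈ A.legal e ↔ ∀ Φ : Position, Φ ≠ [] → IsInit Φ Γ → Run.neg Φ.toRun ∈ A.legal e
    rw [A.legal_iff]
    constructor
    · intro h Φ hne hi
      rw [Position.toRun_neg]
      exact h _ (by simpa [Position.neg] using hne) hi.neg
    · intro h Φ hne hi
      have := h Φ.neg (by simpa [Position.neg] using hne) (by simpa [Run.neg_neg] using hi.neg)
      rwa [Position.toRun_neg, Position.neg_neg] at this
  no_spade := by
    intro e Γ h p n hn
    apply A.no_spade e _ h p.neg n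
    unfold Run.neg
    rw [Stream'.Seq.map_get?, hn]
    rfl
  win_illegal := by
    intro e Γ p h
    obtain ⟨Φ, α, hi, hn, hl⟩ := h
    refine congrArg Player.neg (A.win_illegal e Γ.neg p.neg ?_) |>.trans (by cases p <;> rfl)
    refine ⟨Φ.neg, α, ?_, ?_, ?_⟩
    · simpa [Position.neg] using hi.neg
    · have heq : Φ.neg ++ [(p.neg, α)] = Position.neg (Φ ++ [(p, α)]) := by simp [Position.neg]
      rw [heq, ← Position.toRun_neg]
      exact hn
    · intro Ψ hΨ
      have := hl Ψ.neg (by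
        have := hΨ.map (fun m : LabMove => (m.1.neg, m.2))
        rw [← Position.neg_neg Φ]
        exact this)
      simpa [Position.toRun_neg, Position.neg_neg] using this

theorem take_prefix (Γ : Run) {i j : ℕ} (h : i ≤ j) : Γ.take i <+: Γ.take j := by
  rw [List.prefix_iff_getElem?]
  intro n hn
  have h1 := Stream'.Seq.getElem?_take n i Γ
  have hni : n < i := lt_of_lt_of_le hn Stream'.Seq.length_take_le
  rw [Stream'.Seq.getElem?_take, if_pos (lt_of_lt_of_le hni h), ← List.getElem?_eq_getElem hn, h1,
    if_pos hni]

theorem isInit_take (Γ : Run) (k : ℕ) : IsInit (Γ.take k) Γ := by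
  intro n m hm
  rw [Stream'.Seq.getElem?_take] at hm
  split_ifs at hm
  exact hm

theorem IsInit.prefix_take {Φ : Position} {Γ : Run} (h : IsInit Φ Γ) :
    Φ <+: Γ.take Φ.length := by
  rw [List.prefix_iff_getElem?]
  intro i hi
  rw [Stream'.Seq.getElem?_take, if_pos hi]
  exact h i _ (List.getElem?_eq_getElem hi)

theorem take_toRun (Φ : Position) (k : ℕ) : (Position.toRun Φ).take k <+: Φ :=
  IsInit.toRun_iff.1 (isInit_take _ k)

theorem Run.proj_get? (γ : Move) (Γ : Run) (n : ℕ) (m : LabMove) :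
    (Run.proj γ Γ).get? n = some m ↔
      ∃ k, ((Γ.take k).filterMap (stripPrefix γ))[n]? = some m :=
  Run.limit_get? (fun _ _ h => (take_prefix Γ h).filterMap _) n m

theorem Run.isInit_proj_iff (γ : Move) (Γ : Run) (Ψ : Position) :
    IsInit Ψ (Run.proj γ Γ) ↔ ∃ k, Ψ <+: (Γ.take k).filterMap (stripPrefix γ) := by
  constructor
  · intro h
    induction Ψ using List.reverseRecOn with
    | nil => exact ⟨0, List.nil_prefix⟩
    | append_singleton Ψ m ih =>
      obtain ⟨k, hk⟩ := (Run.proj_get? γ Γ Ψ.length m).1 (h Ψ.length m (by simp))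
      obtain ⟨l, hl⟩ := ih (fun n m' hm' => h n m' (by
        obtain ⟨a, ha⟩ := List.getElem?_eq_some_iff.1 hm'
        rw [List.getElem?_append_left a, hm']))
      have hk' := (take_prefix Γ (le_max_left k l)).filterMap (stripPrefix γ)
      have hl' := hl.trans ((take_prefix Γ (le_max_right k l)).filterMap (stripPrefix γ))
      refine ⟨max k l, ?_⟩
      obtain ⟨T, hT⟩ := hl'
      obtain ⟨S, hS⟩ := hk'
      obtain ⟨a, -⟩ := List.getElem?_eq_some_iff.1 hk
      have hm : ((Γ.take (max k l)).filterMap (stripPrefix γ))[Ψ.length]? = some m := by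
        rw [← hS, List.getElem?_append_left a, hk]
      rw [← hT] at hm ⊢
      cases T with
      | nil => simp at hm
      | cons t T =>
        simp at hm
        subst hm
        exact ⟨T, by simp⟩
  · rintro ⟨k, hk⟩ n m hm
    rw [Run.proj_get?]
    refine ⟨k, ?_⟩
    obtain ⟨T, hT⟩ := hk
    obtain ⟨a, -⟩ := List.getElem?_eq_some_iff.1 hm
    rw [← hT, List.getElem?_append_left a, hm]

/-- The runs in which every move has one of the prefixes `1.`, …, `n.` and whose projection to
each component is legal there. -/
def parLegal {n : ℕ} (A : Fin n → Game) (e : Valuation) : Set Run :=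
  {Γ | (∀ k m, Γ.get? k = some m → ∃ i : Fin n, decimal (i + 1) ++ [Key.dot] <+: m.2) ∧
    ∀ i : Fin n, Run.proj (decimal (i + 1) ++ [Key.dot]) Γ ∈ (A i).legal e}

theorem parLegal_iff {n : ℕ} (A : Fin n → Game) (e : Valuation) (Γ : Run) :
    Γ ∈ parLegal A e ↔
      ∀ Φ : Position, Φ ≠ [] → IsInit Φ Γ → Φ.toRun ∈ parLegal A e := by
  constructor
  · rintro ⟨h1, h2⟩ Φ - hi
    refine ⟨fun k m hm => h1 k m (hi k m (by simpa using hm)), fun i => ?_⟩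
    rw [(A i).legal_iff]
    intro Ψ _ hΨ
    refine (A i).legal_of_init (h2 i) ?_
    rw [Run.isInit_proj_iff] at hΨ ⊢
    obtain ⟨k, hk⟩ := hΨ
    exact ⟨Φ.length, hk.trans (((take_toRun Φ k).trans hi.prefix_take).filterMap _)⟩
  · intro h
    refine ⟨fun k m hm => ?_, fun i => ?_⟩
    · have hk : (Γ.take (k + 1))[k]? = some m := by
        rw [Stream'.Seq.getElem?_take, if_pos (by omega), hm]
      have hne : Γ.take (k + 1) ≠ [] := by
        intro h0
        rw [h0] at hk
        simp at hk
      exact (h _ hne (isInit_take Γ (k + 1))).1 k m (by simpa using hk)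
    · rw [(A i).legal_iff]
      intro Ψ hne hΨ
      rw [Run.isInit_proj_iff] at hΨ
      obtain ⟨k, hk⟩ := hΨ
      have hne' : Γ.take k ≠ [] := by
        intro h0
        rw [h0] at hk
        exact hne (List.prefix_nil.1 (by simpa using hk))
      refine (A i).legal_of_init ((h _ hne' (isInit_take Γ k)).2 i) ?_
      rw [Run.isInit_proj_iff]
      refine ⟨(Γ.take k).length, hk.trans ?_⟩
      exact (IsInit.prefix_take (IsInit.toRun_iff.2 List.prefix_rfl)).filterMap _

open scoped Classical in
/-- Parallel conjunction `A₁ ∧ … ∧ Aₙ`. -/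
noncomputable def Game.pand {n : ℕ} (A : Fin n → Game) : Game :=
  Game.ofLegal (parLegal A)
    (fun e Γ =>
      if ∀ i : Fin n, (A i).win e (Run.proj (decimal (i + 1) ++ [Key.dot]) Γ) = .top
      then .top else .bot)
    (parLegal_iff A)
    (by
      rintro e Γ ⟨h1, -⟩ p k hk
      obtain ⟨i, T, hT⟩ := h1 k _ hk
      rw [List.append_assoc] at hT
      exact decimal_head _ _ hT)

/-- Parallel disjunction `A₁ ∨ … ∨ Aₙ`. -/
noncomputable def Game.por {n : ℕ} (A : Fin n → Game) : Game :=
  (Game.pand fun i => (A i).neg).neg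

/-- Parallel implication `A → B`, i.e. `¬A ∨ B`. -/
noncomputable def Game.imp (A B : Game) : Game := Game.por ![A.neg, B]

/-- The empty run, and the runs in which the environment first makes the move `name i` and which
then continue as a legal run of `A i`. -/
def choiceLegal {ι : Type} (name : ι → Move) (A : ι → Game) (e : Valuation) : Set Run :=
  {Γ | Γ = Stream'.Seq.nil ∨
    ∃ i Δ, Δ ∈ (A i).legal e ∧ Γ = Stream'.Seq.cons (Player.bot, name i) Δ}

theorem choiceLegal_iff {ι : Type} {name : ι → Move} (hname : Function.Injective name)
    (A : ι → Game) (e : Valuation) (Γ : Run) :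
    Γ ∈ choiceLegal name A e ↔
      ∀ Φ : Position, Φ ≠ [] → IsInit Φ Γ → Φ.toRun ∈ choiceLegal name A e := by
  constructor
  · rintro (rfl | ⟨i, Δ, hΔ, rfl⟩) Φ hne hi
    · obtain ⟨m, t, rfl⟩ := List.exists_cons_of_ne_nil hne
      have := hi 0 m (by simp)
      simp at this
    · obtain ⟨m, t, rfl⟩ := List.exists_cons_of_ne_nil hne
      have h0 := hi 0 m (by simp)
      simp at h0
      refine Or.inr ⟨i, Position.toRun t, (A i).legal_of_init hΔ ?_, ?_⟩
      · intro n m' hm'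
        have := hi (n + 1) m' (by simpa using hm')
        simpa using this
      · rw [← h0]; exact Stream'.Seq.ofList_cons _ _
  · intro h
    by_cases hΓ : Γ = Stream'.Seq.nil
    · exact Or.inl hΓ
    · have h0 : Γ.get? 0 ≠ none := fun h0 => hΓ (Stream'.Seq.get?_zero_eq_none.1 h0)
      obtain ⟨m, hm⟩ := Option.ne_none_iff_exists'.1 h0
      have hcons : Γ = Stream'.Seq.cons m Γ.tail := by
        apply Stream'.Seq.ext
        intro n
        cases n with
        | zero => simpa using hm
        | succ n => simp
      have step : ∀ t : Position, IsInit t Γ.tail → ∃ i, m = (Player.bot, name i) ∧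
          Position.toRun t ∈ (A i).legal e := by
        intro t ht
        have hi : IsInit (m :: t) Γ := by
          intro n m' hm'
          cases n with
          | zero => simp at hm'; rw [hm, hm']
          | succ n =>
            have := ht n m' (by simpa using hm')
            simpa using this
        have hc : Position.toRun (m :: t) = Stream'.Seq.cons m (Position.toRun t) :=
          Stream'.Seq.ofList_cons _ _
        rcases h (m :: t) (by simp) hi with h' | ⟨i, Δ, hΔ, h'⟩
        · rw [hc] at h'
          exact absurd h' Stream'.Seq.cons_ne_nil
        · rw [hc, Stream'.Seq.cons_eq_cons] at h'
          exact ⟨i, h'.1, by rw [h'.2]; exact hΔ⟩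
      obtain ⟨i, hi, -⟩ := step [] (fun n m' hm' => by simp at hm')
      refine Or.inr ⟨i, Γ.tail, ?_, by rw [← hi]; exact hcons⟩
      rw [(A i).legal_iff]
      intro Φ _ hΦ
      obtain ⟨j, hj, hleg⟩ := step Φ hΦ
      have : j = i := by
        rw [hi] at hj
        exact hname (Prod.mk.inj hj).2.symm
      rwa [← this]

open scoped Classical in
/-- The environment chooses one of the games `A i` by making the move `name i`; if it does not
choose, the machine wins. -/
noncomputable def Game.choice {ι : Type} (name : ι → Move) (hname : Function.Injective name)
    (hsp : ∀ i, name i ≠ [Key.spade]) (A : ι → Game) : Game :=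
  Game.ofLegal (choiceLegal name A)
    (fun e Γ =>
      if ∃ i Δ, Γ = Stream'.Seq.cons (Player.bot, name i) Δ ∧ (A i).win e Δ = .bot
      then .bot else .top)
    (choiceLegal_iff hname A)
    (by
      rintro e Γ (rfl | ⟨i, Δ, hΔ, rfl⟩) p n
      · simp
      · cases n with
        | zero =>
          intro h
          simp at h
          exact hsp i h.2
        | succ n => simpa using (A i).no_spade e Δ hΔ p n)

/-- Choice conjunction `A₁ ⊓ … ⊓ Aₙ`, the `i`-th game being chosen by the numeral of `i`. -/
noncomputable def Game.cand {n : ℕ} (A : Fin n → Game) : Game :=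
  Game.choice (fun i : Fin n => decimal (i + 1))
    (fun i j h => Fin.ext (by have := decimal_injective h; omega))
    (fun i => by simpa using decimal_head (i + 1) []) A

/-- Choice disjunction `A₁ ⊔ … ⊔ Aₙ`. -/
noncomputable def Game.cor {n : ℕ} (A : Fin n → Game) : Game :=
  (Game.cand fun i => (A i).neg).neg

/-- Choice universal quantification `⊓x A(x)`. -/
noncomputable def Game.call (x : Var) (A : Game) : Game :=
  Game.choice decimal decimal_injective (fun c => by simpa using decimal_head c [])
    (fun c => A.inst x c)

/-- Choice existential quantification `⊔x A(x)`. -/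
noncomputable def Game.cex (x : Var) (A : Game) : Game := (Game.call x A.neg).neg

open scoped Classical in
/-- Blind universal quantification `∀x A(x)`. (For games whose structure does not depend on `x`,
in particular for all games expressed by formulas, the winner of an illegal run is the same with
all values of `x`.) -/
noncomputable def Game.ball (x : Var) (A : Game) : Game :=
  Game.ofLegal A.legal
    (fun e Γ => if ∀ c, (A.inst x c).win e Γ = .top then .top else .bot)
    A.legal_iff A.no_spade

/-- Blind existential quantification `∃x A(x)`. -/
noncomputable def Game.bex (x : Var) (A : Game) : Game := (Game.ball x A.neg).neg

/-! ### Formulas and interpretations -/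

/-- Predicate letters: infinitely many of each arity. -/
structure PredLetter where
  arity : ℕ
  index : ℕ
  deriving DecidableEq

/-- The formulas. The `n`-ary connectives have at least two arguments. -/
inductive Formula where
  | atom (p : PredLetter) (t : Fin p.arity → Term)
  | top
  | bot
  | neg (F : Formula)
  | pand (n : ℕ) (F : Fin (n + 2) → Formula)
  | por (n : ℕ) (F : Fin (n + 2) → Formula)
  | imp (F G : Formula)
  | cand (n : ℕ) (F : Fin (n + 2) → Formula)
  | cor (n : ℕ) (F : Fin (n + 2) → Formula)
  | ball (x : Var) (F : Formula)
  | bex (x : Var) (F : Formula)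
  | call (x : Var) (F : Formula)
  | cex (x : Var) (F : Formula)

/-- The variable `x` occurs in the formula (free, bound, or next to a quantifier). -/
def Formula.Occurs (x : Var) : Formula → Prop
  | .atom _ t => ∃ i, t i = .var x
  | .top => False
  | .bot => False
  | .neg F => F.Occurs x
  | .pand _ F => ∃ i, (F i).Occurs x
  | .por _ F => ∃ i, (F i).Occurs x
  | .imp F G => F.Occurs x ∨ G.Occurs x
  | .cand _ F => ∃ i, (F i).Occurs x
  | .cor _ F => ∃ i, (F i).Occurs x
  | .ball y F => y = x ∨ F.Occurs x
  | .bex y F => y = x ∨ F.Occurs x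
  | .call y F => y = x ∨ F.Occurs x
  | .cex y F => y = x ∨ F.Occurs x

/-- An interpretation sends each predicate letter to an elementary game with an attached tuple of
pairwise distinct variables. -/
structure Interpretation where
  game : PredLetter → Game
  elementary : ∀ p, (game p).IsElementary
  vars : (p : PredLetter) → Fin p.arity → Var
  vars_injective : ∀ p, Function.Injective (vars p)

/-- The game `F*`. -/
noncomputable def Interpretation.apply (I : Interpretation) : Formula → Game
  | .atom p t => (I.game p).subst (I.vars p) t
  | .top => Game.trivial .top
  | .bot => Game.trivial .bot
  | .neg F => (I.apply F).neg
  | .pand _ F => Game.pand fun i => I.apply (F i)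
  | .por _ F => Game.por fun i => I.apply (F i)
  | .imp F G => Game.imp (I.apply F) (I.apply G)
  | .cand _ F => Game.cand fun i => I.apply (F i)
  | .cor _ F => Game.cor fun i => I.apply (F i)
  | .ball x F => Game.ball x (I.apply F)
  | .bex x F => Game.bex x (I.apply F)
  | .call x F => Game.call x (I.apply F)
  | .cex x F => Game.cex x (I.apply F)

/-- `F`-admissible interpretations. -/
def Interpretation.Admissible (I : Interpretation) (F : Formula) : Prop :=
  ∀ p x, F.Occurs x → (∀ i, I.vars p i ≠ x) → ¬ (I.game p).DependsOn x

/-! ### Hard-play machines -/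

/-- What a head sees: the marker at the left end of the tape, or the symbol in a cell. -/
inductive Scanned (S : Type) where
  | leftEnd
  | cell (s : S)

/-- The tapes are infinite to the right. Head position `0` is the left-end marker, head position
`n + 1` is the `n`-th cell. -/
def scan {S : Type} (T : ℕ → S) : ℕ → Scanned S
  | 0 => .leftEnd
  | n + 1 => .cell (T n)

inductive Dir where
  | left
  | stay
  | right

/-- A head at the left end stays there when told to move left. -/
def Dir.shift : Dir → ℕ → ℕ
  | .left, h => h - 1
  | .stay, h => h
  | .right, h => h + 1

/-- Contents of the valuation tape: the numerals of `e(v₀), e(v₁), …`, each followed by a blank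
(`none`). Since each block is nonempty, the first `n + 1` blocks determine the `n`-th cell. -/
def valTape (e : Valuation) (n : ℕ) : Option (Fin 10) :=
  (((List.range (n + 1)).flatMap fun i => (decimalDigits (e i)).map some ++ [none])[n]?).join

/-- Contents of the run tape: the labmoves of the position one after another, each spelled as its
label followed by its move; then blanks. -/
def runTape (Φ : Position) (n : ℕ) : Option (Player ⊕ Key) :=
  (Φ.flatMap fun m => Sum.inl m.1 :: m.2.map Sum.inr)[n]?

/-- The result of one application of the transition function: the next state, the symbol written on
the work tape (`none` is the blank) and the movements of the three heads. -/
structure Action (State Aux : Type) where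
  state : State
  write : Option (Key ⊕ Aux)
  valDir : Dir
  runDir : Dir
  workDir : Dir

/-- A hard-play machine: a Turing machine with a read-only valuation tape, a read-only run tape, and
a read/write work tape whose alphabet consists of the blank, the keyboard symbols and finitely many
auxiliary symbols. -/
structure HPM where
  State : Type
  Aux : Type
  finite_state : Finite State
  finite_aux : Finite Aux
  start : State
  moveStates : Set State
  trans : State → Scanned (Option (Fin 10)) → Scanned (Option (Player ⊕ Key)) →
    Scanned (Option (Key ⊕ Aux)) → Action State Aux

/-- Configurations; `run` is the position spelled on the run tape. -/
structure HPM.Config (H : HPM) where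
  state : H.State
  valHead : ℕ
  runHead : ℕ
  workHead : ℕ
  work : ℕ → Option (Key ⊕ H.Aux)
  run : Position

/-- All tapes but the valuation tape are empty and all heads are at the left end. -/
def HPM.init (H : HPM) : H.Config where
  state := H.start
  valHead := 0
  runHead := 0
  workHead := 0
  work := fun _ => none
  run := []

/-- The longest initial string of keyboard symbols. -/
def leadingKeys {Aux : Type} : List (Option (Key ⊕ Aux)) → Move
  | some (Sum.inl k) :: l => k :: leadingKeys l
  | _ => []

/-- The move constructed on the work tape: the string of keyboard symbols at the beginning of the
tape, delimited by the head (or by the first other symbol). -/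
def HPM.Config.move {H : HPM} (C : H.Config) : Move :=
  leadingKeys ((List.range (C.workHead - 1)).map C.work)

/-- Writing at the left-end marker has no effect. -/
def writeAt {S : Type} (T : ℕ → S) (s : S) : ℕ → (ℕ → S)
  | 0 => T
  | n + 1 => Function.update T n s

open scoped Classical in
/-- The configuration following `C` if the environment makes the moves `βs` during the clock cycle.
The machine makes a move during the cycle iff it is in a move state. -/
noncomputable def HPM.next (H : HPM) (e : Valuation) (C : H.Config) (βs : List Move) : H.Config :=
  let a := H.trans C.state (scan (valTape e) C.valHead) (scan (runTape C.run) C.runHead)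
    (scan C.work C.workHead)
  { state := a.state
    valHead := a.valDir.shift C.valHead
    runHead := a.runDir.shift C.runHead
    workHead := a.workDir.shift C.workHead
    work := writeAt C.work a.write C.workHead
    run := C.run ++ βs.map (fun β => (Player.bot, β)) ++
      (if C.state ∈ H.moveStates then [(Player.top, C.move)] else []) }

/-- `e`-computation branches. -/
def HPM.IsBranch (H : HPM) (e : Valuation) (B : ℕ → H.Config) : Prop :=
  B 0 = H.init ∧ ∀ n, ∃ βs : List Move, B (n + 1) = H.next e (B n) βs

/-- The run spelled by a branch. -/
noncomputable def HPM.spelled {H : HPM} (B : ℕ → H.Config) : Run :=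
  Run.limit fun n => (B n).run

/-- `H` wins `A` on the valuation `e`. -/
def HPM.WinsOn (H : HPM) (e : Valuation) (A : Game) : Prop :=
  ∀ B : ℕ → H.Config, H.IsBranch e B → A.win e (HPM.spelled B) = .top

/-- `H` wins `A`. -/
def HPM.Wins (H : HPM) (A : Game) : Prop := ∀ e, H.WinsOn e A

/-- `A` is computable. -/
def Game.Computable (A : Game) : Prop := ∃ H : HPM, H.Wins A

/-! ### Validity -/

def Formula.Valid (F : Formula) : Prop :=
  ∀ I : Interpretation, I.Admissible F → (I.apply F).Computable

def Formula.UniformlyValid (F : Formula) : Prop :=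
  ∃ H : HPM, ∀ I : Interpretation, I.Admissible F → H.Wins (I.apply F)

end CoL

namespace CoL

/-! ### Congruence of the game operations -/

/-! Only the passage from validity to uniform validity has content; it is a diagonal argument. Up to
renaming states and auxiliary symbols there are countably many machines H_0, H_1, …
(`HPM.exists_code`). If `F` is not uniformly valid, each H_k loses `F` under some admissible I_k at
some valuation. To refute validity, a single interpretation must act like I_k against H_k for every
k. Admissibility permits dependence on variables that do not occur in `F`, so such variables can
carry a number, the marker, and the atoms are read according to I_k at valuations with marker k
(`Interpretation.diagonal`).

The obstacle is that H_k may lose only at valuations with a wrong marker, and altering the valuation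
alters what H_k reads and hence how it plays. So the failure of uniform validity is applied not to
H_k but to a machine (`HPM.reread`) that plays at e as H_k plays at `markValuation N k e`. The
latter arises from e by replacing digits without changing the lengths of numerals, so the heads stay
aligned; the replacement depends only on the index of the block modulo a fixed number, which a
finite control can track by counting the blanks it passes. The modified machine loses under some I_k
at some e. Then H_k produces the same run at the marked valuation, which has marker k and agrees
with e on the variables of `F`, so the diagonal game there is the game of I_k at e
(`Interpretation.agree_diagonal`), and H_k loses it. -/

/-- The game `A` at the valuation `e` coincides with the game `B` at the valuation `e'`. -/
def Game.Agree (A : Game) (e : Valuation) (B : Game) (e' : Valuation) : Prop :=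
  A.legal e = B.legal e' ∧ A.win e = B.win e'

theorem Game.Agree.ofLegal {L L' : Valuation → Set Run} {w w' : Valuation → Run → Player}
    {hL hs hL' hs'} {e e' : Valuation} (h : L e = L' e') (hw : w e = w' e') :
    (Game.ofLegal L w hL hs).Agree e (Game.ofLegal L' w' hL' hs') e' := by
  refine ⟨h, funext fun Γ => ?_⟩
  simp only [Game.ofLegal]
  rw [h, hw]

theorem Game.Agree.neg {A B : Game} {e e' : Valuation} (h : A.Agree e B e') :
    A.neg.Agree e B.neg e' := by
  simp only [Game.Agree, Game.neg, h.1, h.2, and_self]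

open scoped Classical in
theorem Game.Agree.pand {n : ℕ} {A B : Fin n → Game} {e e' : Valuation}
    (h : ∀ i, (A i).Agree e (B i) e') : (Game.pand A).Agree e (Game.pand B) e' := by
  apply Game.Agree.ofLegal
  · simp only [parLegal, (h _).1]
  · exact funext fun Γ => if_congr (by simp only [(h _).2]) rfl rfl

theorem Game.Agree.por {n : ℕ} {A B : Fin n → Game} {e e' : Valuation}
    (h : ∀ i, (A i).Agree e (B i) e') : (Game.por A).Agree e (Game.por B) e' :=
  (Game.Agree.pand fun i => (h i).neg).neg

theorem Game.Agree.imp {A B A' B' : Game} {e e' : Valuation} (h : A.Agree e A' e')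
    (h' : B.Agree e B' e') : (Game.imp A B).Agree e (Game.imp A' B') e' := by
  refine Game.Agree.por fun i => ?_
  fin_cases i
  · exact h.neg
  · exact h'

open scoped Classical in
theorem Game.Agree.choice {ι : Type} {name : ι → Move} {hname hsp} {A B : ι → Game}
    {e e' : Valuation} (h : ∀ i, (A i).Agree e (B i) e') :
    (Game.choice name hname hsp A).Agree e (Game.choice name hname hsp B) e' := by
  apply Game.Agree.ofLegal
  · simp only [choiceLegal, (h _).1]
  · exact funext fun Γ => if_congr (by simp only [(h _).2]) rfl rfl

theorem Game.Agree.cand {n : ℕ} {A B : Fin n → Game} {e e' : Valuation}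
    (h : ∀ i, (A i).Agree e (B i) e') : (Game.cand A).Agree e (Game.cand B) e' :=
  Game.Agree.choice h

theorem Game.Agree.cor {n : ℕ} {A B : Fin n → Game} {e e' : Valuation}
    (h : ∀ i, (A i).Agree e (B i) e') : (Game.cor A).Agree e (Game.cor B) e' :=
  (Game.Agree.choice fun i => (h i).neg).neg

theorem Game.Agree.call {x : Var} {A B : Game} {e e' : Valuation}
    (h : ∀ c, A.Agree (Function.update e x c) B (Function.update e' x c)) :
    (Game.call x A).Agree e (Game.call x B) e' :=
  Game.Agree.choice fun c => h c

theorem Game.Agree.cex {x : Var} {A B : Game} {e e' : Valuation}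
    (h : ∀ c, A.Agree (Function.update e x c) B (Function.update e' x c)) :
    (Game.cex x A).Agree e (Game.cex x B) e' :=
  (Game.Agree.call fun c => (h c).neg).neg

open scoped Classical in
-- The legal runs of a blind quantification are those of `A` at the valuation itself, so agreement
-- at the updated valuations alone would not suffice.
theorem Game.Agree.ball {x : Var} {A B : Game} {e e' : Valuation} (h : A.Agree e B e')
    (hc : ∀ c, A.Agree (Function.update e x c) B (Function.update e' x c)) :
    (Game.ball x A).Agree e (Game.ball x B) e' := by
  apply Game.Agree.ofLegal h.1
  exact funext fun Γ => if_congr (by simp only [Game.inst, (hc _).2]) rfl rfl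

theorem Game.Agree.bex {x : Var} {A B : Game} {e e' : Valuation} (h : A.Agree e B e')
    (hc : ∀ c, A.Agree (Function.update e x c) B (Function.update e' x c)) :
    (Game.bex x A).Agree e (Game.bex x B) e' :=
  (Game.Agree.ball h.neg fun c => (hc c).neg).neg

theorem Game.Agree.trivial (p : Player) (e e' : Valuation) :
    (Game.trivial p).Agree e (Game.trivial p) e' :=
  Game.Agree.ofLegal rfl rfl

/-! ### Elementary games. -/

theorem Game.nil_mem_legal (A : Game) (e : Valuation) : Stream'.Seq.nil ∈ A.legal e :=
  (A.legal_iff e _).2 fun Φ hne hi => by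
    obtain ⟨m, t, rfl⟩ := List.exists_cons_of_ne_nil hne
    simpa using hi 0 m (by simp)

theorem Game.IsElementary.legal_eq {A : Game} (hA : A.IsElementary) (e : Valuation) :
    A.legal e = {Stream'.Seq.nil} :=
  Set.Subset.antisymm (fun Γ h => hA e Γ h) (by simpa using A.nil_mem_legal e)

/-- At a given valuation, an elementary game is determined by the winner of the empty run. -/
theorem Game.IsElementary.agree {A B : Game} (hA : A.IsElementary) (hB : B.IsElementary)
    {e e' : Valuation} (h : A.win e Stream'.Seq.nil = B.win e' Stream'.Seq.nil) :
    A.Agree e B e' := by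
  have hleg : A.legal e = B.legal e' := by rw [hA.legal_eq, hB.legal_eq]
  refine ⟨hleg, funext fun Γ => ?_⟩
  by_cases hΓ : Γ = Stream'.Seq.nil
  · rw [hΓ, h]
  -- The first move of a nonempty run is already illegal in both games, so its author loses both.
  · have h0 : Γ.get? 0 ≠ none := fun h0 => hΓ (Stream'.Seq.get?_zero_eq_none.1 h0)
    obtain ⟨⟨p, α⟩, hm⟩ := Option.ne_none_iff_exists'.1 h0
    have hill : IllegalBy (A.legal e) p Γ := by
      refine ⟨[], α, ?_, ?_, ?_⟩
      · intro n m' hm'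
        cases n with
        | zero => simp at hm'; rw [hm, hm']
        | succ n => simp at hm'
      · intro hmem
        have h2 := congrArg (fun Δ : Run => Δ.get? 0) (hA e _ hmem)
        simp at h2
      · intro Ψ hΨ
        rw [List.prefix_nil.1 hΨ]
        exact A.nil_mem_legal e
    rw [A.win_illegal e Γ p hill, B.win_illegal e' Γ p (hleg ▸ hill)]

/-! ### Dependence of interpreted formulas on the valuation -/

/-- `e` and `e'` coincide on `S`, and agree with `b` and `b'`, respectively, outside `S`. -/
structure Linked (S : Set Var) (b b' e e' : Valuation) : Prop where
  on : ∀ x ∈ S, e x = e' x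
  left : ∀ x ∉ S, e x = b x
  right : ∀ x ∉ S, e' x = b' x

theorem Linked.update {S : Set Var} {b b' e e' : Valuation} (h : Linked S b b' e e') {x : Var}
    (hx : x ∈ S) (c : ℕ) :
    Linked S b b' (Function.update e x c) (Function.update e' x c) where
  on y hy := by
    by_cases hyx : y = x
    · simp [hyx]
    · simp [hyx, h.on y hy]
  left y hy := by
    rw [Function.update_of_ne (fun hyx : y = x => hy (hyx.symm ▸ hx)), h.left y hy]
  right y hy := by
    rw [Function.update_of_ne (fun hyx : y = x => hy (hyx.symm ▸ hx)), h.right y hy]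

theorem Linked.eval {S : Set Var} {b b' e e' : Valuation} (h : Linked S b b' e e') {t : Term}
    (ht : ∀ x, t = .var x → x ∈ S) : t.eval e = t.eval e' := by
  cases t with
  | var x => exact h.on x (ht x rfl)
  | const c => rfl

/-- A quantifier in `G` resets a variable of `S` to the same constant on both sides, which preserves
the link, so agreement propagates upwards from the atoms. The base valuations `b` and `b'` stay
fixed throughout, so that `hatom` can refer to them. -/
theorem Interpretation.agree_apply {I J : Interpretation} {S : Set Var} {b b' : Valuation}
    (hatom : ∀ p t e e', Linked S b b' e e' → (∀ i x, t i = .var x → x ∈ S) →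
      (I.apply (.atom p t)).Agree e (J.apply (.atom p t)) e')
    (G : Formula) (hG : ∀ x, G.Occurs x → x ∈ S) {e e' : Valuation} (h : Linked S b b' e e') :
    (I.apply G).Agree e (J.apply G) e' := by
  induction G generalizing e e' with
  | atom p t => exact hatom p t e e' h fun i x hx => hG x ⟨i, hx⟩
  | top => exact Game.Agree.trivial _ _ _
  | bot => exact Game.Agree.trivial _ _ _
  | neg F ih => exact (ih hG h).neg
  | pand n F ih => exact Game.Agree.pand fun i => ih i (fun x hx => hG x ⟨i, hx⟩) h
  | por n F ih => exact Game.Agree.por fun i => ih i (fun x hx => hG x ⟨i, hx⟩) h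
  | imp F G ihF ihG =>
    exact Game.Agree.imp (ihF (fun x hx => hG x (Or.inl hx)) h)
      (ihG (fun x hx => hG x (Or.inr hx)) h)
  | cand n F ih => exact Game.Agree.cand fun i => ih i (fun x hx => hG x ⟨i, hx⟩) h
  | cor n F ih => exact Game.Agree.cor fun i => ih i (fun x hx => hG x ⟨i, hx⟩) h
  | ball x F ih =>
    have hF := fun y hy => hG y (Or.inr hy)
    exact Game.Agree.ball (ih hF h) fun c => ih hF (h.update (hG x (Or.inl rfl)) c)
  | bex x F ih =>
    have hF := fun y hy => hG y (Or.inr hy)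
    exact Game.Agree.bex (ih hF h) fun c => ih hF (h.update (hG x (Or.inl rfl)) c)
  | call x F ih =>
    have hF := fun y hy => hG y (Or.inr hy)
    exact Game.Agree.call fun c => ih hF (h.update (hG x (Or.inl rfl)) c)
  | cex x F ih =>
    have hF := fun y hy => hG y (Or.inr hy)
    exact Game.Agree.cex fun c => ih hF (h.update (hG x (Or.inl rfl)) c)

/-- Leaves all variables from `N` on free for argument tuples and markers. -/
theorem Formula.exists_bound (F : Formula) : ∃ N, ∀ x, F.Occurs x → x < N := by
  have vec : ∀ {n : ℕ} {P : Fin n → Var → Prop}, (∀ i, ∃ N, ∀ x, P i x → x < N) →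
      ∃ N, ∀ x, (∃ i, P i x) → x < N := by
    intro n P h
    choose N hN using h
    exact ⟨Finset.univ.sup N, fun x ⟨i, hx⟩ =>
      (hN i x hx).trans_le (Finset.le_sup (f := N) (Finset.mem_univ i))⟩
  have quant : ∀ {P : Var → Prop} (y : Var), (∃ N, ∀ x, P x → x < N) →
      ∃ N, ∀ x, (y = x ∨ P x) → x < N := by
    rintro P y ⟨N, hN⟩
    refine ⟨max N (y + 1), ?_⟩
    rintro x (rfl | hx)
    · exact lt_max_of_lt_right (Nat.lt_succ_self _)
    · exact lt_max_of_lt_left (hN x hx)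
  induction F with
  | atom p t =>
    refine vec fun i => ?_
    cases h : t i with
    | var y => exact ⟨y + 1, fun x hx => by cases hx; exact Nat.lt_succ_self _⟩
    | const c => exact ⟨0, fun x hx => by cases hx⟩
  | top => exact ⟨0, fun _ h => h.elim⟩
  | bot => exact ⟨0, fun _ h => h.elim⟩
  | neg F ih => exact ih
  | pand n F ih => exact vec ih
  | por n F ih => exact vec ih
  | imp F G ihF ihG =>
    obtain ⟨N, hN⟩ := ihF
    obtain ⟨M, hM⟩ := ihG
    exact ⟨max N M, fun x hx => lt_max_iff.2 (hx.imp (hN x) (hM x))⟩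
  | cand n F ih => exact vec ih
  | cor n F ih => exact vec ih
  | ball x F ih => exact quant x ih
  | bex x F ih => exact quant x ih
  | call x F ih => exact quant x ih
  | cex x F ih => exact quant x ih

/-- Dependence concerns the change of a single variable, so the values are changed one at a time,
from the largest index down; the bound `N` makes this a finite process. -/
theorem Game.win_eq_of_not_dependsOn (A : Game) {N : ℕ} {e e' : Valuation}
    (h : ∀ x, e x ≠ e' x → x < N ∧ ¬ A.DependsOn x) : A.win e = A.win e' := by
  induction N generalizing e with
  | zero =>
    have : e = e' := funext fun x => by
      by_contra hx
      exact absurd (h x hx).1 (Nat.not_lt_zero x)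
    rw [this]
  | succ N ih =>
    rw [← ih (e := Function.update e N (e' N))]
    · by_cases hN : e N = e' N
      · rw [← hN, Function.update_eq_self]
      · by_contra hne
        exact (h N hN).2 ⟨e, _, fun y hy => (Function.update_of_ne hy _ _).symm, Or.inr hne⟩
    · intro x hx
      have hxN : x ≠ N := by
        rintro rfl
        simp at hx
      rw [Function.update_of_ne hxN] at hx
      exact ⟨lt_of_le_of_ne (Nat.lt_succ_iff.1 (h x hx).1) hxN, (h x hx).2⟩

/-! ### Blockwise modification of the valuation tape -/

/-- The blocks on the valuation tape of the variables in `l`. -/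
def tapeBlocks (e : Valuation) (l : List Var) : List (Option (Fin 10)) :=
  l.flatMap fun i => (decimalDigits (e i)).map some ++ [none]

theorem length_le_tapeBlocks (e : Valuation) (l : List Var) :
    l.length ≤ (tapeBlocks e l).length := by
  induction l with
  | nil => simp
  | cons i l ih =>
    simp only [tapeBlocks, List.flatMap_cons, List.length_append, List.length_cons] at ih ⊢
    omega

/-- Each block contains at least its closing blank, so the first `n + 1` blocks already cover cell
`n`, and further blocks do not move it. -/
theorem valTape_eq (e : Valuation) {n K : ℕ} (h : n < K) :
    valTape e n = (tapeBlocks e (List.range K))[n]?.join := by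
  have hlen := length_le_tapeBlocks e (List.range (n + 1))
  rw [List.length_range] at hlen
  obtain ⟨d, rfl⟩ : ∃ d, K = n + 1 + d := ⟨K - (n + 1), by omega⟩
  have : tapeBlocks e (List.range (n + 1 + d)) = tapeBlocks e (List.range (n + 1)) ++
      tapeBlocks e ((List.range d).map (n + 1 + ·)) := by
    rw [tapeBlocks, List.range_add, List.flatMap_append]
    rfl
  rw [this, List.getElem?_append_left (by omega)]
  rfl

/-- The number of blanks among the first `n` cells of the tape `T`. -/
def blanks (T : ℕ → Option (Fin 10)) : ℕ → ℕ
  | 0 => 0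
  | n + 1 => blanks T n + if T n = none then 1 else 0

theorem blanks_valTape (e : Valuation) {n K : ℕ} (h : n ≤ K) :
    blanks (valTape e) n = ((tapeBlocks e (List.range K)).take n).count none := by
  induction n with
  | zero => simp [blanks]
  | succ n ih =>
    have hlen := length_le_tapeBlocks e (List.range K)
    rw [List.length_range] at hlen
    have hn : n < (tapeBlocks e (List.range K)).length := by omega
    rw [blanks, ih (by omega), valTape_eq e (show n < K by omega), List.take_add_one,
      List.count_append, List.getElem?_eq_getElem hn]
    cases (tapeBlocks e (List.range K))[n] <;> simp

/-- Equal lengths of numerals keep the two tapes aligned, and the blanks before a cell tell its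
block. The induction peels off the first block, hence the variable starting index `s`; cell `n` lies
among its digits, on its blank, or beyond it. -/
theorem getElem?_tapeBlocks_modify {e e' : Valuation} {g : ℕ → Fin 10 → Fin 10}
    (h : ∀ i, decimalDigits (e' i) = (decimalDigits (e i)).map (g i)) (s K n : ℕ) :
    (tapeBlocks e' (List.range' s K))[n]?.join = ((tapeBlocks e (List.range' s K))[n]?.join).map
      (g (s + ((tapeBlocks e (List.range' s K)).take n).count none)) := by
  induction K generalizing s n with
  | zero => simp [tapeBlocks]
  | succ K ih =>
    have cons : ∀ e : Valuation, tapeBlocks e (List.range' s (K + 1)) =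
        (decimalDigits (e s)).map some ++ none :: tapeBlocks e (List.range' (s + 1) K) := by
      intro e
      simp [tapeBlocks, List.range'_succ]
    have hcount : ∀ l : List (Fin 10), (l.map some).count none = 0 := by
      intro l
      simp [List.count_eq_zero]
    rw [cons, cons, h s]
    obtain hlt | heq | hgt := lt_trichotomy n (decimalDigits (e s)).length
    · rw [List.getElem?_append_left (by simpa using hlt),
        List.getElem?_append_left (by simpa using hlt),
        List.take_append_of_le_length (by simpa using hlt.le), ← List.map_take, hcount]
      simp [List.getElem?_eq_getElem hlt]
    · subst heq
      simp
    · obtain ⟨d, rfl⟩ : ∃ d, n = (decimalDigits (e s)).length + (d + 1) :=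
        ⟨n - (decimalDigits (e s)).length - 1, by omega⟩
      rw [List.getElem?_append_right (by simp), List.getElem?_append_right (by simp),
        List.take_append, List.count_append, List.take_of_length_le (by simp), hcount]
      simp only [List.length_map, Nat.add_sub_cancel_left, List.getElem?_cons_succ,
        List.take_succ_cons, List.count_cons_self]
      rw [ih]
      congr 2
      omega

theorem valTape_modify {e e' : Valuation} {g : ℕ → Fin 10 → Fin 10}
    (h : ∀ i, decimalDigits (e' i) = (decimalDigits (e i)).map (g i)) (n : ℕ) :
    valTape e' n = (valTape e n).map (g (blanks (valTape e) n)) := by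
  have := getElem?_tapeBlocks_modify h 0 (n + 1) n
  rw [← List.range_eq_range', Nat.zero_add, ← blanks_valTape e (Nat.le_succ n),
    ← valTape_eq e' (Nat.lt_succ_self n), ← valTape_eq e (Nat.lt_succ_self n)] at this
  exact this

/-! ### Numerals of prescribed length. -/

theorem decimalDigits_ne_nil (c : ℕ) : decimalDigits c ≠ [] := by
  unfold decimalDigits
  split_ifs with hc
  · simp
  · simpa using Nat.digits_ne_nil_iff_ne_zero.2 hc

/-- The number whose decimal numeral consists of `n` digits `d`. -/
def repdigit (d : Fin 10) (n : ℕ) : ℕ := Nat.ofDigits 10 (List.replicate n (d : ℕ))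

/-- As `d` is nonzero there is no leading zero, so no digit is lost. -/
theorem decimalDigits_repdigit {d : Fin 10} (hd : d ≠ 0) {n : ℕ} (hn : n ≠ 0) :
    decimalDigits (repdigit d n) = List.replicate n d := by
  have hd' : (d : ℕ) ≠ 0 := fun h => hd (Fin.ext h)
  have hdig : Nat.digits 10 (repdigit d n) = List.replicate n (d : ℕ) := by
    apply Nat.digits_ofDigits 10 (by norm_num)
    · intro l hl
      rw [List.eq_of_mem_replicate hl]
      exact d.2
    · intro h
      simpa using hd'
  have h0 : repdigit d n ≠ 0 := by
    intro h
    rw [h, Nat.digits_zero] at hdig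
    exact hn (by simpa using (congrArg List.length hdig).symm)
  rw [decimalDigits, if_neg h0, hdig]
  simp

theorem repdigit_mod (d : Fin 10) {n : ℕ} (hn : n ≠ 0) : repdigit d n % 10 = d := by
  obtain ⟨n, rfl⟩ := Nat.exists_eq_succ_of_ne_zero hn
  have := d.2
  rw [repdigit, List.replicate_succ, Nat.ofDigits_cons]
  omega

/-! ### Machines with a modified view of the valuation tape -/

/-- `1` if the scanned cell is blank. -/
def blankCount (m : ℕ) : Scanned (Option (Fin 10)) → ZMod m
  | .cell none => 1
  | _ => 0

/-- Recover the number of blanks to the left of the scanned cell: the flag tells that the scanned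
cell has been counted in. -/
def currentCount {m : ℕ} (c : ZMod m × Bool) (v : Scanned (Option (Fin 10))) : ZMod m :=
  if c.2 then c.1 - blankCount m v else c.1

/-- After a move to the left it is unknown until the next cycle whether the newly scanned cell is a
blank already counted; the flag postpones the correction to `currentCount`. Counting modulo `m`
keeps the counter finite and yet reversible, unlike a counter capped at a bound. -/
def nextCount {m : ℕ} (c : ZMod m) (v : Scanned (Option (Fin 10))) : Dir → ZMod m × Bool
  | .left => (c, true)
  | .stay => (c, false)
  | .right => (c + blankCount m v, false)

def Scanned.modify (f : Fin 10 → Fin 10) : Scanned (Option (Fin 10)) → Scanned (Option (Fin 10))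
  | .leftEnd => .leftEnd
  | .cell o => .cell (o.map f)

/-- The machine that works as `H` does, but sees the digits in the block of `vᵢ` on the valuation
tape replaced according to `g i`, where `i` is counted modulo `m`. -/
def HPM.reread (H : HPM) (m : ℕ) [NeZero m] (g : ZMod m → Fin 10 → Fin 10) : HPM where
  State := H.State × ZMod m × Bool
  Aux := H.Aux
  finite_state := by
    have := H.finite_state
    have : Finite (ZMod m) := Finite.of_fintype _
    infer_instance
  finite_aux := H.finite_aux
  start := (H.start, 0, false)
  moveStates := {s | s.1 ∈ H.moveStates}
  trans s v r w :=
    let c := currentCount s.2 v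
    let a := H.trans s.1 (v.modify (g c)) r w
    ⟨(a.state, nextCount c v a.valDir), a.write, a.valDir, a.runDir, a.workDir⟩

/-- Forgetting the counter of a modified machine. -/
def HPM.Config.ofReread {H : HPM} {m : ℕ} [NeZero m] {g : ZMod m → Fin 10 → Fin 10}
    (C : (H.reread m g).Config) : H.Config :=
  ⟨C.state.1, C.valHead, C.runHead, C.workHead, C.work, C.run⟩

/-- The invariant of the counter. Head position `h` scans cell `h - 1`, so the cells to its left are
the first `h - 1`. -/
theorem currentCount_nextCount {m : ℕ} (T : ℕ → Option (Fin 10)) (h : ℕ) (d : Dir) :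
    currentCount (nextCount (blanks T (h - 1) : ZMod m) (scan T h) d) (scan T (d.shift h)) =
      (blanks T (d.shift h - 1) : ZMod m) := by
  have hb : ∀ n, (blanks T (n + 1) : ZMod m) = blanks T n + blankCount m (.cell (T n)) := by
    intro n
    cases hn : T n <;> simp [blanks, blankCount, hn]
  cases d with
  | stay => rfl
  | right =>
    cases h with
    | zero => simp [currentCount, nextCount, scan, blankCount, Dir.shift, blanks]
    | succ h => exact (hb h).symm
  | left =>
    match h with
    -- From these positions the head ends at the left-end marker, where nothing has to be
    -- subtracted.
    | 0 | 1 => simp [currentCount, nextCount, scan, blankCount, Dir.shift, blanks]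
    | h + 2 => simp [currentCount, nextCount, scan, Dir.shift, hb h]

/-- With the environment's moves kept, the correct count makes each modified symbol equal to the one
`H` would scan on the tape of `e'`, so erasing the counter gives a branch of `H`. -/
theorem HPM.exists_branch_of_reread {H : HPM} {m : ℕ} [NeZero m] {g : ZMod m → Fin 10 → Fin 10}
    {e e' : Valuation} (h : ∀ i, decimalDigits (e' i) = (decimalDigits (e i)).map (g (i : ZMod m)))
    {B : ℕ → (H.reread m g).Config} (hB : (H.reread m g).IsBranch e B) :
    ∃ B' : ℕ → H.Config, H.IsBranch e' B' ∧ HPM.spelled B' = HPM.spelled B := by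
  have hcount : ∀ n, currentCount (B n).state.2 (scan (valTape e) (B n).valHead) =
      (blanks (valTape e) ((B n).valHead - 1) : ZMod m) := by
    intro n
    induction n with
    | zero => rw [hB.1]; simp [HPM.init, HPM.reread, currentCount, blanks]
    | succ n ih =>
      obtain ⟨βs, hβ⟩ := hB.2 n
      rw [hβ]
      refine Eq.trans ?_ (currentCount_nextCount (valTape e) (B n).valHead _)
      rw [← ih]
      rfl
  refine ⟨fun n => (B n).ofReread, ⟨?_, fun n => ?_⟩, rfl⟩
  · show (B 0).ofReread = H.init
    rw [hB.1]
    rfl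
  · obtain ⟨βs, hβ⟩ := hB.2 n
    refine ⟨βs, ?_⟩
    have hscan : (scan (valTape e) (B n).valHead).modify
        (g (currentCount (B n).state.2 (scan (valTape e) (B n).valHead))) =
        scan (valTape e') (B n).valHead := by
      rw [hcount]
      cases (B n).valHead with
      | zero => rfl
      | succ k =>
        have := valTape_modify (g := fun i => g (i : ZMod m)) h k
        exact congrArg Scanned.cell this.symm
    show (B (n + 1)).ofReread = H.next e' (B n).ofReread βs
    rw [hβ]
    simp only [HPM.next, HPM.Config.ofReread]
    rw [← hscan]
    rfl

/-! ### Countably many machines -/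

/-- A machine whose states and auxiliary symbols are initial segments of the natural numbers. -/
abbrev HPMCode := Σ n a : ℕ, Fin n × Set (Fin n) ×
  (Fin n → Scanned (Option (Fin 10)) → Scanned (Option (Player ⊕ Key)) →
    Scanned (Option (Key ⊕ Fin a)) → Action (Fin n) (Fin a))

def HPMCode.toHPM (c : HPMCode) : HPM where
  State := Fin c.1
  Aux := Fin c.2.1
  finite_state := inferInstance
  finite_aux := inferInstance
  start := c.2.2.1
  moveStates := c.2.2.2.1
  trans := c.2.2.2.2

instance : Finite Player :=
  Finite.of_injective (fun p : Player => decide (p = .top)) (by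
    intro p q h
    cases p <;> cases q <;> simp_all)

instance : Finite Dir :=
  Finite.of_injective (fun | .left => 0 | .stay => 1 | .right => 2 : Dir → Fin 3) (by
    intro p q h
    cases p <;> cases q <;> simp_all)

instance : Finite Key :=
  Finite.of_injective
    (fun | .digit d => .inl d | .dot => .inr (.inl 0) | .other i => .inr (.inr i)
         | .spade => .inr (.inl 1) : Key → Fin 10 ⊕ Fin 2 ⊕ Fin 84) (by
    intro p q h
    cases p <;> cases q <;> simp_all)

instance {S : Type} [Finite S] : Finite (Scanned S) :=
  Finite.of_injective (fun | .leftEnd => none | .cell s => some s : Scanned S → Option S) (by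
    intro p q h
    cases p <;> cases q <;> simp_all)

instance {S A : Type} [Finite S] [Finite A] : Finite (Action S A) :=
  Finite.of_injective (fun a : Action S A => (a.state, a.write, a.valDir, a.runDir, a.workDir)) (by
    rintro ⟨⟩ ⟨⟩ h
    simpa using h)

/-! ### Renaming the symbols of the work tape. -/

def Scanned.map {S S' : Type} (f : S → S') : Scanned S → Scanned S'
  | .leftEnd => .leftEnd
  | .cell s => .cell (f s)

theorem scan_map {S S' : Type} (f : S → S') (T : ℕ → S) (h : ℕ) :
    scan (fun n => f (T n)) h = (scan T h).map f := by
  cases h <;> rfl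

theorem writeAt_map {S S' : Type} (f : S → S') (T : ℕ → S) (s : S) (h : ℕ) :
    (fun n => f (writeAt T s h n)) = writeAt (fun n => f (T n)) (f s) h := by
  cases h with
  | zero => rfl
  | succ h => exact (Function.comp_update f T h s)

theorem leadingKeys_map {A A' : Type} (f : A → A') (l : List (Option (Key ⊕ A))) :
    leadingKeys (l.map (Option.map (Sum.map id f))) = leadingKeys l := by
  induction l with
  | nil => rfl
  | cons a l ih =>
    match a with
    | none => rfl
    | some (.inl k) => exact congrArg (k :: ·) ih
    | some (.inr b) => rfl

/-- Every machine behaves like a coded one. -/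
theorem HPM.exists_code (H : HPM) : ∃ c : HPMCode, ∀ e (B : ℕ → c.toHPM.Config),
    c.toHPM.IsBranch e B → ∃ B' : ℕ → H.Config, H.IsBranch e B' ∧
      HPM.spelled B' = HPM.spelled B := by
  have := H.finite_state
  have := H.finite_aux
  obtain ⟨n, ⟨σ⟩⟩ := Finite.exists_equiv_fin H.State
  obtain ⟨a, ⟨α⟩⟩ := Finite.exists_equiv_fin H.Aux
  let f : Option (Key ⊕ Fin a) → Option (Key ⊕ H.Aux) := Option.map (Sum.map id α.symm)
  let c : HPMCode := ⟨n, a, σ H.start, {s | σ.symm s ∈ H.moveStates}, fun s v r w =>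
    let b := H.trans (σ.symm s) v r (w.map f)
    ⟨σ b.state, b.write.map (Sum.map id α), b.valDir, b.runDir, b.workDir⟩⟩
  let back : c.toHPM.Config → H.Config := fun C =>
    ⟨σ.symm C.state, C.valHead, C.runHead, C.workHead, fun n => f (C.work n), C.run⟩
  refine ⟨c, fun e B hB => ⟨fun n => back (B n), ⟨?_, fun n => ?_⟩, rfl⟩⟩
  · show back (B 0) = H.init
    rw [hB.1]
    exact congrArg (fun s => (⟨s, 0, 0, 0, fun _ => none, []⟩ : H.Config)) (σ.symm_apply_apply _)
  · obtain ⟨βs, hβ⟩ := hB.2 n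
    refine ⟨βs, ?_⟩
    have hmove : (back (B n)).move = (B n).move := by
      refine Eq.trans ?_
        (leadingKeys_map α.symm ((List.range ((B n).workHead - 1)).map (B n).work))
      exact congrArg leadingKeys (List.map_map (f := (B n).work) (g := f)).symm
    have hwrite : ∀ o : Option (Key ⊕ H.Aux), f (o.map (Sum.map id α)) = o := by
      rintro (_ | _ | x)
      · rfl
      · rfl
      · exact congrArg (fun y => some (Sum.inr y)) (α.symm_apply_apply x)
    show back (B (n + 1)) = H.next e (back (B n)) βs
    rw [hβ]
    simp only [HPM.next, hmove]
    have hs : scan (back (B n)).work (back (B n)).workHead =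
        (scan (B n).work (B n).workHead).map f := scan_map f _ _
    rw [hs]
    simp only [back]
    rw [HPM.Config.mk.injEq]
    refine ⟨σ.symm_apply_apply _, rfl, rfl, rfl, ?_, rfl⟩
    exact (writeAt_map f _ _ _).trans (congrArg (fun o => writeAt _ o _) (hwrite _))

/-! ### Valuations marked by a natural number -/

/-- The number coded by the values of the variables with indices `N + 1, N + 3, N + 5, …`. -/
noncomputable def marker (N : ℕ) (e : Valuation) : ℕ := sInf {j | e (N + 2 * j + 1) % 10 = 2}

theorem marker_congr {N : ℕ} {e e' : Valuation}
    (h : ∀ j, e (N + 2 * j + 1) = e' (N + 2 * j + 1)) : marker N e = marker N e' := by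
  simp only [marker, h]

/-- The digit that replaces `d` in the blocks of the variables with index `c` modulo
`N + 2 * k + 2`. -/
def markDigit (N k : ℕ) (c : ZMod (N + 2 * k + 2)) (d : Fin 10) : Fin 10 :=
  if c.val < N then d else if c.val = N + 2 * k + 1 then 2 else 1

/-- A valuation with the marker `k` whose tape arises from that of `e` by replacing digits, and
which agrees with `e` on the first `N` variables. -/
def markValuation (N k : ℕ) (e : Valuation) : Valuation := fun i =>
  if i % (N + 2 * k + 2) < N then e i
  else repdigit (if i % (N + 2 * k + 2) = N + 2 * k + 1 then 2 else 1) (decimalDigits (e i)).length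

theorem decimalDigits_markValuation (N k : ℕ) (e : Valuation) (i : ℕ) :
    decimalDigits (markValuation N k e i) =
      (decimalDigits (e i)).map (markDigit N k (i : ZMod (N + 2 * k + 2))) := by
  have hlen : (decimalDigits (e i)).length ≠ 0 := by simpa using decimalDigits_ne_nil (e i)
  unfold markValuation markDigit
  rw [ZMod.val_natCast]
  split_ifs
  · simp
  · rw [decimalDigits_repdigit (by decide) hlen, List.map_const']
  · rw [decimalDigits_repdigit (by decide) hlen, List.map_const']

theorem markValuation_of_lt {N k i : ℕ} (e : Valuation) (h : i < N) :
    markValuation N k e i = e i := by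
  rw [markValuation, Nat.mod_eq_of_lt (by omega), if_pos h]

theorem markValuation_mod_ten {N k i : ℕ} (e : Valuation) (hN : N ≤ i) (hi : i < N + 2 * k + 2) :
    markValuation N k e i % 10 = if i = N + 2 * k + 1 then 2 else 1 := by
  have hlen : (decimalDigits (e i)).length ≠ 0 := by simpa using decimalDigits_ne_nil (e i)
  rw [markValuation, Nat.mod_eq_of_lt hi, if_neg (not_lt.2 hN), repdigit_mod _ hlen]
  split_ifs <;> rfl

/-- The positions that matter lie in the first period of the modification: numerals end in 1 for `j
< k` and in 2 for `j = k`. Later periods cannot lower the infimum. -/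
theorem marker_markValuation (N k : ℕ) (e : Valuation) : marker N (markValuation N k e) = k := by
  have hk : markValuation N k e (N + 2 * k + 1) % 10 = 2 := by
    rw [markValuation_mod_ten e (by omega) (by omega), if_pos rfl]
  refine le_antisymm (Nat.sInf_le hk) (le_csInf ⟨k, hk⟩ fun j hj => ?_)
  by_contra hlt
  have hj' : markValuation N k e (N + 2 * j + 1) % 10 = 2 := hj
  rw [markValuation_mod_ten e (by omega) (by omega), if_neg (by omega)] at hj'
  exact absurd hj' (by decide)

/-! ### The diagonal interpretation -/

/-- The elementary game won by `w e` at the valuation `e`. -/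
noncomputable def Game.elementary (w : Valuation → Player) : Game :=
  Game.ofLegal (fun _ => {Stream'.Seq.nil}) (fun e _ => w e)
    (Game.trivial .top).legal_iff (Game.trivial .top).no_spade

theorem Game.elementary_win_nil (w : Valuation → Player) (e : Valuation) :
    (Game.elementary w).win e Stream'.Seq.nil = w e :=
  if_pos rfl

/-- The interpretation that interprets predicate letters according to `M k` at the valuations with
the marker `k`. -/
noncomputable def Interpretation.diagonal (N : ℕ)
    (M : ℕ → (p : PredLetter) → (Fin p.arity → ℕ) → Player) : Interpretation where
  game p := Game.elementary fun e => M (marker N e) p fun i => e (N + 2 * i)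
  elementary _ _ _ h := h
  vars _ i := N + 2 * i
  vars_injective _ i j h := Fin.ext (by
    have h' : N + 2 * (i : ℕ) = N + 2 * (j : ℕ) := h
    omega)

/-- The game of a letter reads only its attached tuple and the marker variables, and the latter lie
beyond all variables of `F`. -/
theorem Interpretation.diagonal_admissible {N : ℕ} {F : Formula} (hN : ∀ x, F.Occurs x → x < N)
    (M : ℕ → (p : PredLetter) → (Fin p.arity → ℕ) → Player) :
    (Interpretation.diagonal N M).Admissible F := by
  rintro p x hx hvars ⟨e₁, e₂, heq, hne⟩
  have hxN := hN x hx
  have hagree : (Game.elementary fun e => M (marker N e) p fun i => e (N + 2 * i)).Agree e₁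
      (Game.elementary fun e => M (marker N e) p fun i => e (N + 2 * i)) e₂ := by
    refine Game.Agree.ofLegal rfl (funext fun _ => ?_)
    have h1 : marker N e₁ = marker N e₂ :=
      marker_congr fun j => heq _ (Nat.ne_of_gt (hxN.trans_le
        ((Nat.le_add_right N (2 * j)).trans (Nat.le_succ _))))
    have h2 : (fun i : Fin p.arity => e₁ (N + 2 * i)) = fun i : Fin p.arity => e₂ (N + 2 * i) :=
      funext fun i => heq _ (hvars i)
    simp only [h1, h2]
  exact hne.elim (fun h => h hagree.1) (fun h => h hagree.2)

/-- Quantifiers in `F` change the valuations only at variables of `F`, so the marker of `e'`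
survives inside the formula and still selects the right component of `M`. That component records the
letters of `I` at the original `e` rather than at the changed valuation; the two differ, outside the
tuple, only at variables of `F`, where admissibility makes the difference irrelevant. -/
theorem Interpretation.agree_diagonal {I : Interpretation} {N : ℕ} {F : Formula}
    (hN : ∀ x, F.Occurs x → x < N) (hI : I.Admissible F)
    {M : ℕ → (p : PredLetter) → (Fin p.arity → ℕ) → Player} {e e' : Valuation}
    (he : ∀ x < N, e' x = e x)
    (hM : ∀ p a, M (marker N e') p a =
      (I.game p).win (Function.extend (I.vars p) a e) Stream'.Seq.nil) :
    (I.apply F).Agree e ((Interpretation.diagonal N M).apply F) e' := by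
  refine Interpretation.agree_apply (S := {x | F.Occurs x}) (b := e) (b' := e') ?_ F
    (fun _ h => h) ⟨fun x hx => (he x (hN x hx)).symm, fun _ _ => rfl, fun _ _ => rfl⟩
  intro p t e₁ e₂ hlink ht
  refine Game.IsElementary.agree (fun _ => I.elementary p _)
    (fun _ => (Interpretation.diagonal N M).elementary p _) ?_
  refine Eq.trans ?_ (Game.elementary_win_nil _ _).symm
  have hinj := (Interpretation.diagonal N M).vars_injective p
  have hmark : marker N (Function.extend ((Interpretation.diagonal N M).vars p)
      (fun i => (t i).eval e₂) e₂) = marker N e' := by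
    refine marker_congr fun j => ?_
    rw [Function.extend_apply']
    · refine hlink.right _ fun hj => ?_
      have hlt : N + 2 * j + 1 < N := hN _ hj
      omega
    -- Parity of the offset from `N` separates tuple variables from marker variables.
    · rintro ⟨i, hi⟩
      have hi' : N + 2 * (i : ℕ) = N + 2 * j + 1 := hi
      omega
  have hargs : (fun i : Fin p.arity => Function.extend ((Interpretation.diagonal N M).vars p)
      (fun i => (t i).eval e₂) e₂ (N + 2 * i)) = fun i => (t i).eval e₁ := by
    funext i
    exact (hinj.extend_apply _ _ i).trans (hlink.eval (ht i)).symm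
  rw [hmark, hargs, hM]
  refine congrFun ((I.game p).win_eq_of_not_dependsOn (N := N) fun x hx => ?_) _
  have hvars : ∀ i, I.vars p i ≠ x := by
    rintro i rfl
    simp only [(I.vars_injective p).extend_apply, ne_eq, not_true_eq_false] at hx
  rw [Function.extend_apply' _ _ _ (fun ⟨i, hi⟩ => hvars i hi),
    Function.extend_apply' _ _ _ (fun ⟨i, hi⟩ => hvars i hi)] at hx
  have hocc : F.Occurs x := by
    by_contra hocc
    exact hx (hlink.left x hocc)
  exact ⟨hN x hocc, hI p x hocc hvars⟩

/-! ### The diagonal argument. -/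

/-- If `F` is not uniformly valid, then every machine loses it at a valuation with any prescribed
marker, under an interpretation that may depend on the marker. -/
theorem Formula.exists_lost_branch {F : Formula} (hF : ¬ F.UniformlyValid) {N : ℕ}
    (hN : ∀ x, F.Occurs x → x < N) (H : HPM) (k : ℕ) :
    ∃ M₀ : (p : PredLetter) → (Fin p.arity → ℕ) → Player,
      ∀ M : ℕ → (p : PredLetter) → (Fin p.arity → ℕ) → Player, M k = M₀ →
        ∃ e B, H.IsBranch e B ∧
          ((Interpretation.diagonal N M).apply F).win e (HPM.spelled B) ≠ .top := by
  -- The modified machine, not `H` itself, is tested against uniform validity.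
  have hlose : ¬ ∀ I : Interpretation, I.Admissible F →
      (H.reread (N + 2 * k + 2) (markDigit N k)).Wins (I.apply F) := fun h => hF ⟨_, h⟩
  simp only [HPM.Wins, HPM.WinsOn, not_forall] at hlose
  obtain ⟨I, hI, e, B, hB, hwin⟩ := hlose
  refine ⟨fun p a => (I.game p).win (Function.extend (I.vars p) a e) Stream'.Seq.nil, ?_⟩
  intro M hM
  obtain ⟨B', hB', hsp⟩ := HPM.exists_branch_of_reread (decimalDigits_markValuation N k e) hB
  refine ⟨_, B', hB', ?_⟩
  have hagree := Interpretation.agree_diagonal (M := M) hN hI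
    (fun x hx => markValuation_of_lt (k := k) e hx)
    (fun p a => by rw [marker_markValuation, hM])
  rw [hsp, ← hagree.2]
  exact hwin

theorem Formula.Valid.uniformlyValid {F : Formula} (h : F.Valid) : F.UniformlyValid := by
  by_contra hF
  obtain ⟨N, hN⟩ := F.exists_bound
  -- Validity under a constant interpretation supplies a machine, hence a code; the enumeration of
  -- codes needs one to exist.
  obtain ⟨H₀, -⟩ := h _ (Interpretation.diagonal_admissible hN fun _ _ _ => .top)
  have : Nonempty HPMCode := ⟨H₀.exists_code.choose⟩
  -- For fixed numbers of states and auxiliary symbols there are finitely many codes, so all codes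
  -- form a countable set.
  obtain ⟨code, hcode⟩ := exists_surjective_nat HPMCode
  -- The `k`-th machine loses however the other components of `M` are filled, so the components can
  -- be chosen independently.
  choose M hM using fun k => Formula.exists_lost_branch hF hN (code k).toHPM k
  obtain ⟨H, hH⟩ := h _ (Interpretation.diagonal_admissible hN M)
  obtain ⟨c, hc⟩ := H.exists_code
  obtain ⟨k, rfl⟩ := hcode c
  obtain ⟨e, B, hB, hwin⟩ := hM k M rfl
  obtain ⟨B', hB', hsp⟩ := hc e B hB
  exact hwin (hsp ▸ hH e B' hB')

theorem Formula.UniformlyValid.valid {F : Formula} (h : F.UniformlyValid) : F.Valid := by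
  obtain ⟨H, hH⟩ := h
  exact fun I hI => ⟨H, hH I hI⟩

end CoL

theorem theorem5p5 (F : CoL.Formula) : F.Valid ↔ F.UniformlyValid :=
  ⟨CoL.Formula.Valid.uniformlyValid, CoL.Formula.UniformlyValid.valid⟩
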